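/- Fix $q\in\mathbb C^\times$, not a root of unity, and $n\ge 0$; put $N=2n$. Let $M$ be the field of meromorphic functions $f(\underline\lambda)$ on $\mathbb C^{N}$, let $\omega(i)=e_i$ be the standard basis vectors, $T_\alpha f(\underline\lambda)=f(\underline\lambda+\alpha)$, and $$h(x)=q\,\frac{q^{-2x}-q^{-2}}{q^{-2x}-1},\qquad g(x)=h(x)h(-x).$$ Let $\mathscr F=\mathscr F_R(M(N))$ be the unital associative $\mathbb C$-algebra generated by $t_{ij}$ ($1\le i,j\le N$) and two copies of the algebra $M$, with elements $\mu_l(f)=f(\underline\lambda)$ and $\mu_r(f)=f(\underline\mu)$, subject to $f_1(\underline\lambda)f_2(\underline\mu)=f_2(\underline\mu)f_1(\underline\lambda)$, $f(\underline\lambda)t_{ij}=t_{ij}f(\underline\lambda+\omega(i))$, $f(\underline\mu)t_{ij}=t_{ij}f(\underline\mu+\omega(j))$ and the dynamical $RTT$ relations \begin{align*} h(\mu_k-\mu_l)t_{ik}t_{il}&=t_{il}t_{ik} && (k<l),\\ h(\lambda_j-\lambda_i)t_{jk}t_{ik}&=t_{ik}t_{jk} && (i<j),\\ t_{ik}t_{jl}&=t_{jl}t_{ik}+\bigl(h(\lambda_j-\lambda_i)-h(\mu_k-\mu_l)\bigr)t_{jk}t_{il}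 && (i<j,\ k<l),\\ g(\mu_k-\mu_l)t_{ik}t_{jl}&=g(\lambda_i-\lambda_j)t_{jl}t_{ik}+\bigl(h(\mu_l-\mu_k)-h(\lambda_i-\lambda_j)\bigr)t_{il}t_{jk} && (i<j,\ k<l),\\ t_{il}t_{jk}&=g(\mu_k-\mu_l)t_{jk}t_{il}+\bigl(h(\lambda_j-\lambda_i)-h(\mu_l-\mu_k)\bigr)t_{jl}t_{ik} && (i<j,\ k<l). \end{align*} For $I=\{i_1<\dots<i_r\}$ and $\sigma\in S_r$ put $S(\sigma,I)=\prod_{k<l,\ \sigma(k)>\sigma(l)}\bigl(-h(\lambda_{i_{\sigma(k)}}-\lambda_{i_{\sigma(l)}})\bigr)\in M$. For $I,J$ with $|I|=|J|=r$ the dynamical quantum minor is $$\xi^I_J=\mu_r(S(\rho,J)^{-1})\sum_{\sigma\in S_r}\mu_l(S(\sigma,I))\,t_{i_{\sigma(1)}j_{\rho(1)}}\cdots t_{i_{\sigma(r)}j_{\rho(r)}},$$ where $\rho\in S_r$ is arbitrary (the statement below holds for every choice of the permutations $\rho$ in the minors that occur), and $\det(T)=\xi^{[1,N]}_{[1,N]}$.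 Let $\mathcal B$ be a $\mathbb C$-algebra with an algebra homomorphism $M\to\mathcal B$ and elements $b_{kl}$, $1\le k<l\le N$. For a ring $A$ with a ring homomorphism $M\to A$ and a family $X=(x_{ij})_{i<j}$ in $A$ put $$\mathrm{Pf}(X)=\sum_{\sigma\in\Pi}S(\sigma,[1,N])\,x_{\sigma(1)\sigma(2)}\cdots x_{\sigma(2n-1)\sigma(2n)},\qquad \Pi=\{\sigma\in S_{2n}:\sigma(2a-1)<\sigma(2a),\ 1\le a\le n\}.$$ Let $\mathscr F\,\widetilde\otimes\,\mathcal B$ be the quotient of the vector space $\mathscr F\otimes_{\mathbb C}\mathcal B$ by the span $J$ of all $\mu_r(f)t\otimes b-t\otimes fb$, with $f(t\otimes b)=\mu_l(f)t\otimes b$ for $f\in M$, and let $c_{ij}=\sum_{k<l}\xi^{ij}_{kl}\otimes b_{kl}$ ($i<j$), $C=(c_{ij})$, $B=(b_{ij})$. Let $\mathrm{Pf}(C)$ be formed with the factorwise product $(t\otimes b)(t'\otimes b')=tt'\otimes bb'$ of these tensors and with $f\in M$ acting as $\mu_l(f)\otimes 1$. Then $$\mathrm{Pf}(C)=\det(T)\otimes\mathrm{Pf}(B)\qquad\text{in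 }\mathscr F\,\widetilde\otimes\,\mathcal B .$$ If moreover $f\,b_{kl}=b_{kl}\,T_{\omega(k)+\omega(l)}f$ for all $f\in M$ and $k<l$, then the $c_{ij}$ and the $\mu_l(f)\otimes 1$ lie in the subspace $\{x: xJ\subseteq J\}/J$ of $\mathscr F\,\widetilde\otimes\,\mathcal B$, which is an algebra under the (there well-defined) factorwise product, and the same identity holds with $\mathrm{Pf}(C)$ computed in this algebra. -/

import Mathlib

open scoped TensorProduct

noncomputable section

namespace DynPf

/-! ### Meromorphic functions on `ℂ^N` -/

/-- The algebra of entire functions on `ℂ^N`. -/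
def Entire (N : ℕ) : Subalgebra ℂ ((Fin N → ℂ) → ℂ) where
  carrier := {f | AnalyticOnNhd ℂ f Set.univ}
  mul_mem' hf hg := AnalyticOnNhd.mul hf hg
  add_mem' hf hg := AnalyticOnNhd.add hf hg
  algebraMap_mem' _ := analyticOnNhd_const

instance instIsDomainEntire (N : ℕ) : IsDomain (Entire N) := by
  have : NoZeroDivisors (Entire N) := by
    refine ⟨fun {f g} h => ?_⟩
    by_contra hne
    push Not at hne
    obtain ⟨hf, hg⟩ := hne
    apply hg
    obtain ⟨x, hx⟩ : ∃ x, f.1 x ≠ 0 := by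
      by_contra hcon
      push Not at hcon
      exact hf (Subtype.ext (funext hcon))
    have hev : ∀ᶠ y in nhds x, f.1 y ≠ 0 :=
      (f.2 x (Set.mem_univ x)).continuousAt.eventually_ne hx
    have hgz : g.1 =ᶠ[nhds x] 0 := by
      filter_upwards [hev] with y hy
      have hfg : f.1 y * g.1 y = 0 := congrFun (congrArg Subtype.val h) y
      exact (mul_eq_zero.mp hfg).resolve_left hy
    exact Subtype.ext (AnalyticOnNhd.eq_of_eventuallyEq g.2 analyticOnNhd_const hgz)
  exact NoZeroDivisors.to_isDomain _

/-- The field of meromorphic functions on `𝔥* = ℂ^N`: on `ℂ^N` the (global) meromorphic functions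
are exactly the quotients of entire functions. -/
def Mer (N : ℕ) : Type := FractionRing (Entire N)

instance instFieldMer (N : ℕ) : Field (Mer N) := inferInstanceAs (Field (FractionRing (Entire N)))

instance instAlgebraEntireMer (N : ℕ) : Algebra (Entire N) (Mer N) :=
  inferInstanceAs (Algebra (Entire N) (FractionRing (Entire N)))

instance instIsFractionRingMer (N : ℕ) : IsFractionRing (Entire N) (Mer N) :=
  inferInstanceAs (IsFractionRing (Entire N) (FractionRing (Entire N)))

instance instAlgebraMer (N : ℕ) : Algebra ℂ (Mer N) :=
  ((algebraMap (Entire N) (Mer N)).comp (algebraMap ℂ (Entire N))).toAlgebra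

instance instIsScalarTowerMer (N : ℕ) : IsScalarTower ℂ (Entire N) (Mer N) :=
  IsScalarTower.of_algebraMap_eq fun _ => rfl

/-- Translation `f ↦ f(· + α)` of entire functions. -/
def translate {N : ℕ} (α : Fin N → ℂ) : Entire N →ₐ[ℂ] Entire N where
  toFun f := ⟨fun x => f.1 (x + α), fun x _ =>
    AnalyticAt.fun_comp (f.2 (x + α) (Set.mem_univ _)) (analyticAt_id.add analyticAt_const)⟩
  map_one' := rfl
  map_mul' _ _ := rfl
  map_zero' := rfl
  map_add' _ _ := rfl
  commutes' _ := rfl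

/-- Translation by `α` as an automorphism of the algebra of entire functions. -/
def translateEquiv {N : ℕ} (α : Fin N → ℂ) : Entire N ≃ₐ[ℂ] Entire N :=
  AlgEquiv.ofAlgHom (translate α) (translate (-α))
    (by
      ext f x
      change f.1 (x + α + -α) = f.1 x
      rw [add_neg_cancel_right])
    (by
      ext f x
      change f.1 (x + -α + α) = f.1 x
      rw [neg_add_cancel_right])

/-- The automorphism `T_α` of the field of meromorphic functions, `(T_α f)(λ) = f(λ + α)`. -/
def T {N : ℕ} (α : Fin N → ℂ) : Mer N ≃+* Mer N :=
  IsFractionRing.ringEquivOfRingEquiv (translateEquiv α).toRingEquiv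

/-- The weight `ω(i) = e_i`. -/
def ω {N : ℕ} (i : Fin N) : Fin N → ℂ := Pi.single i 1

/-- The entire function `λ ↦ q^{-2(λ_i - λ_j)}`. -/
def qexp {N : ℕ} (q : ℂ) (i j : Fin N) : Entire N :=
  ⟨fun x => Complex.exp (Complex.log q * (-2 * (x i - x j))), fun x _ => by
    have hp : ∀ k : Fin N, AnalyticAt ℂ (fun y : Fin N → ℂ => y k) x := fun k =>
      (ContinuousLinearMap.proj (R := ℂ) (φ := fun _ : Fin N => ℂ) k).analyticAt x
    exact (analyticAt_const.mul (analyticAt_const.mul ((hp i).sub (hp j)))).cexp⟩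

/-- `q^{-2(λ_i - λ_j)}` as a meromorphic function. -/
def X {N : ℕ} (q : ℂ) (i j : Fin N) : Mer N := algebraMap (Entire N) (Mer N) (qexp q i j)

/-- The meromorphic function `h(λ_i - λ_j)`, where
`h(λ) = q (q^{-2λ} - q^{-2}) / (q^{-2λ} - 1)`. -/
def h {N : ℕ} (q : ℂ) (i j : Fin N) : Mer N :=
  algebraMap ℂ (Mer N) q * (X q i j - algebraMap ℂ (Mer N) (q ^ (-2 : ℤ))) / (X q i j - 1)

/-- The meromorphic function `g(λ_i - λ_j) = h(λ_i - λ_j) h(λ_j - λ_i)`. -/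
def g {N : ℕ} (q : ℂ) (i j : Fin N) : Mer N := h q i j * h q j i

/-! ### The dynamical quantum matrix algebra -/

/-- Generators: `f(λ)`, `f(μ)` for meromorphic `f`, and `t_{ij}`. -/
inductive Gen (N : ℕ) : Type
  | l (f : Mer N) : Gen N
  | r (f : Mer N) : Gen N
  | t (i j : Fin N) : Gen N

/-- `f(λ)` in the free algebra. -/
def freeL {N : ℕ} (f : Mer N) : FreeAlgebra ℂ (Gen N) := FreeAlgebra.ι ℂ (Gen.l f)

/-- `f(μ)` in the free algebra. -/
def freeR {N : ℕ} (f : Mer N) : FreeAlgebra ℂ (Gen N) := FreeAlgebra.ι ℂ (Gen.r f)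

/-- `t_{ij}` in the free algebra. -/
def freeT {N : ℕ} (i j : Fin N) : FreeAlgebra ℂ (Gen N) := FreeAlgebra.ι ℂ (Gen.t i j)

/-- The defining relations. The first six make the two copies of the meromorphic functions
images of algebra homomorphisms; the last five are the components of the dynamical relation
`∑ R^{xy}_{ac}(λ) t_{xb} t_{yd} = ∑ R^{bd}_{xy}(μ) t_{cy} t_{ax}`. The relation `diag'`, multiplied
by `h(λ_j - λ_i) - h(μ_k - μ_l)`, is equivalent (modulo `diag`) to the more usual `anti`; since
that factor is not invertible, `diag'` is not a consequence of the other ones. -/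
inductive Rel {N : ℕ} (q : ℂ) : FreeAlgebra ℂ (Gen N) → FreeAlgebra ℂ (Gen N) → Prop
  | l_scalar (c : ℂ) : Rel q (freeL (algebraMap ℂ (Mer N) c)) (algebraMap ℂ _ c)
  | l_add (f f' : Mer N) : Rel q (freeL (f + f')) (freeL f + freeL f')
  | l_mul (f f' : Mer N) : Rel q (freeL (f * f')) (freeL f * freeL f')
  | r_scalar (c : ℂ) : Rel q (freeR (algebraMap ℂ (Mer N) c)) (algebraMap ℂ _ c)
  | r_add (f f' : Mer N) : Rel q (freeR (f + f')) (freeR f + freeR f')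
  | r_mul (f f' : Mer N) : Rel q (freeR (f * f')) (freeR f * freeR f')
  | l_r (f f' : Mer N) : Rel q (freeL f * freeR f') (freeR f' * freeL f)
  | l_t (f : Mer N) (i j : Fin N) : Rel q (freeL f * freeT i j) (freeT i j * freeL (T (ω i) f))
  | r_t (f : Mer N) (i j : Fin N) : Rel q (freeR f * freeT i j) (freeT i j * freeR (T (ω j) f))
  | row (i k l : Fin N) (hkl : k < l) :
      Rel q (freeR (h q k l) * (freeT i k * freeT i l)) (freeT i l * freeT i k)
  | col (i j k : Fin N) (hij : i < j) :
      Rel q (freeL (h q j i) * (freeT j k * freeT i k)) (freeT i k * freeT j k)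
  | diag (i j k l : Fin N) (hij : i < j) (hkl : k < l) :
      Rel q (freeT i k * freeT j l)
        (freeT j l * freeT i k + (freeL (h q j i) - freeR (h q k l)) * (freeT j k * freeT i l))
  | anti (i j k l : Fin N) (hij : i < j) (hkl : k < l) :
      Rel q (freeR (g q k l) * (freeT i k * freeT j l))
        (freeL (g q i j) * (freeT j l * freeT i k)
          + (freeR (h q l k) - freeL (h q i j)) * (freeT i l * freeT j k))
  | diag' (i j k l : Fin N) (hij : i < j) (hkl : k < l) :
      Rel q (freeT i l * freeT j k)
        (freeR (g q k l) * (freeT j k * freeT i l)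
          + (freeL (h q j i) - freeR (h q l k)) * (freeT j l * freeT i k))

/-- The algebra `F_R(M(N))`. -/
def FR (q : ℂ) (N : ℕ) : Type := RingQuot (Rel (N := N) q)

instance instRingFR (q : ℂ) (N : ℕ) : Ring (FR q N) :=
  inferInstanceAs (Ring (RingQuot (Rel (N := N) q)))

instance instAlgebraFR (q : ℂ) (N : ℕ) : Algebra ℂ (FR q N) :=
  inferInstanceAs (Algebra ℂ (RingQuot (Rel (N := N) q)))

/-- The quotient map from the free algebra. -/
def toFR (q : ℂ) (N : ℕ) : FreeAlgebra ℂ (Gen N) →ₐ[ℂ] FR q N := RingQuot.mkAlgHom ℂ (Rel q)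

theorem toFR_rel {q : ℂ} {N : ℕ} {x y : FreeAlgebra ℂ (Gen N)} (hxy : Rel q x y) :
    toFR q N x = toFR q N y := RingQuot.mkAlgHom_rel ℂ hxy

/-- The generator `t_{ij}`. -/
def t (q : ℂ) {N : ℕ} (i j : Fin N) : FR q N := toFR q N (freeT i j)

/-- The left moment map `μ_l(f) = f(λ)`. -/
def muL (q : ℂ) {N : ℕ} : Mer N →ₐ[ℂ] FR q N :=
  AlgHom.ofLinearMap
    { toFun := fun f => toFR q N (freeL f)
      map_add' := fun f f' => by
        rw [toFR_rel (q := q) (Rel.l_add f f'), map_add]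
      map_smul' := fun c f => by
        rw [Algebra.smul_def, toFR_rel (q := q) (Rel.l_mul _ f), map_mul,
          toFR_rel (q := q) (Rel.l_scalar c), AlgHom.commutes, ← Algebra.smul_def]
        rfl }
    (by
      have h1 := toFR_rel (q := q) (Rel.l_scalar (q := q) (N := N) 1)
      simpa using h1)
    (fun f f' => by
      have h1 := toFR_rel (q := q) (Rel.l_mul (q := q) f f')
      simpa using h1)

/-- The right moment map `μ_r(f) = f(μ)`. -/
def muR (q : ℂ) {N : ℕ} : Mer N →ₐ[ℂ] FR q N :=
  AlgHom.ofLinearMap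
    { toFun := fun f => toFR q N (freeR f)
      map_add' := fun f f' => by
        rw [toFR_rel (q := q) (Rel.r_add f f'), map_add]
      map_smul' := fun c f => by
        rw [Algebra.smul_def, toFR_rel (q := q) (Rel.r_mul _ f), map_mul,
          toFR_rel (q := q) (Rel.r_scalar c), AlgHom.commutes, ← Algebra.smul_def]
        rfl }
    (by
      have h1 := toFR_rel (q := q) (Rel.r_scalar (q := q) (N := N) 1)
      simpa using h1)
    (fun f f' => by
      have h1 := toFR_rel (q := q) (Rel.r_mul (q := q) f f')
      simpa using h1)

/-! ### Generalized signs, minors, determinant, Pfaffian -/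

/-- The generalized sign `S(σ, I)`, where `I` lists the elements `i_1 < ⋯ < i_r`. -/
def sgn (q : ℂ) {N r : ℕ} (σ : Equiv.Perm (Fin r)) (I : Fin r → Fin N) : Mer N :=
  ∏ p : Fin r × Fin r with p.1 < p.2 ∧ σ p.2 < σ p.1, -h q (I (σ p.1)) (I (σ p.2))

/-- The dynamical quantum minor `ξ^I_J`, written with the auxiliary permutation `ρ`; here `I`, `J`
list the rows and the columns in increasing order. -/
def minor (q : ℂ) {N r : ℕ} (ρ : Equiv.Perm (Fin r)) (I J : Fin r → Fin N) : FR q N :=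
  muR q (sgn q ρ J)⁻¹ *
    ∑ σ : Equiv.Perm (Fin r),
      muL q (sgn q σ I) * (List.ofFn fun a : Fin r => t q (I (σ a)) (J (ρ a))).prod

/-- The dynamical quantum determinant, written with the auxiliary permutation `ρ`. -/
def det (q : ℂ) {N : ℕ} (ρ : Equiv.Perm (Fin N)) : FR q N := minor q ρ id id

/-- The first element of the `a`-th pair of consecutive positions. -/
def fstPos {n : ℕ} (a : Fin n) : Fin (2 * n) := ⟨2 * a.1, by omega⟩

/-- The second element of the `a`-th pair of consecutive positions. -/
def sndPos {n : ℕ} (a : Fin n) : Fin (2 * n) := ⟨2 * a.1 + 1, by omega⟩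

/-- The set `Π` of permutations `σ` with `σ(2a-1) < σ(2a)` for `a = 1, …, n`. -/
def shuffles (n : ℕ) : Finset (Equiv.Perm (Fin (2 * n))) :=
  {σ | ∀ a : Fin n, σ (fstPos a) < σ (sndPos a)}

/-- The dynamical quantum Pfaffian of a family `x_{ij}` in a ring `A` over the meromorphic
functions (only the entries with `i < j` occur). -/
def Pf (q : ℂ) {n : ℕ} {A : Type*} [Ring A] (ι : Mer (2 * n) →+* A)
    (x : Fin (2 * n) → Fin (2 * n) → A) : A :=
  ∑ σ ∈ shuffles n,
    ι (sgn q σ id) * (List.ofFn fun a : Fin n => x (σ (fstPos a)) (σ (sndPos a))).prod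

/-! ### The twisted tensor product -/

section Twisted

variable (q : ℂ) {N : ℕ} {B : Type*} [Ring B] [Algebra ℂ B] (ι : Mer N →ₐ[ℂ] B)

/-- The subspace spanned by the elements `μ_r(f)t ⊗ b - t ⊗ f b` of the usual tensor product. -/
def relations : Submodule ℂ (FR q N ⊗[ℂ] B) :=
  Submodule.span ℂ
    {z | ∃ (f : Mer N) (s : FR q N) (b : B), z = (muR q f * s) ⊗ₜ[ℂ] b - s ⊗ₜ[ℂ] (ι f * b)}

/-- The twisted tensor product as a vector space. -/
abbrev Twisted : Type _ := (FR q N ⊗[ℂ] B) ⧸ relations q ι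

/-- The class of an element of the usual tensor product. -/
def cls : FR q N ⊗[ℂ] B →ₗ[ℂ] Twisted q ι := (relations q ι).mkQ

/-- The left action `f (s ⊗ b) = μ_l(f) s ⊗ b` of the meromorphic functions, as multiplication by
the element `μ_l(f) ⊗ 1`. -/
def leftAct (B : Type*) [Ring B] [Algebra ℂ B] : Mer N →ₐ[ℂ] FR q N ⊗[ℂ] B :=
  Algebra.TensorProduct.includeLeft.comp (muL q)

theorem relations_mul_mem {y : FR q N ⊗[ℂ] B} (hy : y ∈ relations q ι) (z : FR q N ⊗[ℂ] B) :
    y * z ∈ relations q ι := by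
  induction hy using Submodule.span_induction with
  | mem y hy =>
    obtain ⟨f, s, b, rfl⟩ := hy
    induction z using TensorProduct.induction_on with
    | zero => simp
    | tmul s' b' =>
      rw [sub_mul, Algebra.TensorProduct.tmul_mul_tmul, Algebra.TensorProduct.tmul_mul_tmul,
        mul_assoc, mul_assoc]
      exact Submodule.subset_span ⟨f, s * s', b * b', rfl⟩
    | add z z' hz hz' => rw [mul_add]; exact Submodule.add_mem _ hz hz'
  | zero => simp
  | add y y' _ _ hy hy' => rw [add_mul]; exact Submodule.add_mem _ hy hy'
  | smul c y _ hy => rw [smul_mul_assoc]; exact Submodule.smul_mem _ c hy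

/-- The elements of the usual tensor product by which one can multiply from the left modulo the
relations. -/
def multipliers : Subalgebra ℂ (FR q N ⊗[ℂ] B) where
  carrier := {x | ∀ y ∈ relations q ι, x * y ∈ relations q ι}
  mul_mem' {x x'} hx hx' y hy := by rw [mul_assoc]; exact hx _ (hx' y hy)
  add_mem' {x x'} hx hx' y hy := by
    rw [add_mul]; exact Submodule.add_mem _ (hx y hy) (hx' y hy)
  algebraMap_mem' c y hy := by
    rw [← Algebra.smul_def]; exact Submodule.smul_mem _ c hy

/-- Equality modulo the relations, on the multipliers. -/
def relCon : RingCon (multipliers q ι) where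
  r x y := (x : FR q N ⊗[ℂ] B) - y ∈ relations q ι
  iseqv :=
    { refl := fun x => by simp
      symm := fun {x y} hxy => by
        have := (relations q ι).neg_mem hxy
        rwa [neg_sub] at this
      trans := fun {x y z} hxy hyz => by
        have := (relations q ι).add_mem hxy hyz
        rwa [sub_add_sub_cancel] at this }
  mul' {w x y z} hwx hyz := by
    have h1 := w.2 _ hyz
    have h2 := relations_mul_mem q ι hwx (z : FR q N ⊗[ℂ] B)
    have h3 := Submodule.add_mem _ h1 h2
    have h4 : (w : FR q N ⊗[ℂ] B) * (y - z) + (w - x) * z = w * y - x * z := by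
      rw [mul_sub, sub_mul, sub_add_sub_cancel]
    rw [h4] at h3
    exact h3
  add' {w x y z} hwx hyz := by
    have h3 := (relations q ι).add_mem hwx hyz
    have h4 : ((w : FR q N ⊗[ℂ] B) - x) + (y - z) = (w + y) - (x + z) := by abel
    rw [h4] at h3
    exact h3

/-- The part of the twisted tensor product on which the factorwise product
`(s ⊗ b)(s' ⊗ b') = s s' ⊗ b b'` is well defined. It contains the classes of
the `s ⊗ b` with `f(μ) s = s f(μ + β)` and `f(λ) b = b f(λ + β)` for a common weight `β`. -/
abbrev TwistedAlg : Type _ := (relCon q ι).Quotient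

/-- The class of a multiplier. -/
def TwistedAlg.cls : multipliers q ι →+* TwistedAlg q ι := (relCon q ι).mk'

/-- The inclusion of `TwistedAlg` into the twisted tensor product. -/
def TwistedAlg.incl : TwistedAlg q ι → Twisted q ι :=
  Quotient.lift (fun x : multipliers q ι => DynPf.cls q ι x)
    fun _ _ hxy => (Submodule.Quotient.eq _).2 hxy

theorem TwistedAlg.incl_cls (x : multipliers q ι) :
    TwistedAlg.incl q ι (TwistedAlg.cls q ι x) = DynPf.cls q ι x := rfl

theorem TwistedAlg.incl_injective : Function.Injective (TwistedAlg.incl q ι) := by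
  intro x y
  refine Quotient.inductionOn₂ x y fun x y hxy => Quotient.sound ?_
  exact (Submodule.Quotient.eq _).1 hxy

/-- The element `c_{ij} = ∑_{k<l} ξ^{ij}_{kl} ⊗ b_{kl}` of the usual tensor product; the minor
`ξ^{ij}_{kl}` is written with the auxiliary permutation `κ i j k l`. -/
def cElt (κ : Fin N → Fin N → Fin N → Fin N → Equiv.Perm (Fin 2)) (b : Fin N → Fin N → B)
    (i j : Fin N) : FR q N ⊗[ℂ] B :=
  ∑ p : Fin N × Fin N with p.1 < p.2,
    minor q (κ i j p.1 p.2) ![i, j] ![p.1, p.2] ⊗ₜ[ℂ] b p.1 p.2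

/-- The `b_{kl}`, `k < l`, have weight `ω(k) + ω(l)`: `f(λ) b_{kl} = b_{kl} f(λ + ω(k) + ω(l))`. -/
def IsHomogeneous (b : Fin N → Fin N → B) : Prop :=
  ∀ k l : Fin N, k < l → ∀ f : Mer N, ι f * b k l = b k l * ι (T (ω k + ω l) f)

theorem T_comp_algebraMap (α : Fin N → ℂ) (f : Entire N) :
    T α (algebraMap (Entire N) (Mer N) f) = algebraMap (Entire N) (Mer N) (translate α f) :=
  IsFractionRing.ringEquivOfRingEquiv_algebraMap _ _

theorem T_add (α β : Fin N → ℂ) (f : Mer N) : T (α + β) f = T β (T α f) := by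
  have key : (T (α + β) : Mer N ≃+* Mer N).toRingHom
      = (T β).toRingHom.comp (T α).toRingHom := by
    refine IsLocalization.ringHom_ext (nonZeroDivisors (Entire N)) (RingHom.ext fun f => ?_)
    change T (α + β) (algebraMap _ _ f) = T β (T α (algebraMap _ _ f))
    rw [T_comp_algebraMap, T_comp_algebraMap, T_comp_algebraMap]
    congr 1
    ext x
    change f.1 (x + (α + β)) = f.1 (x + β + α)
    rw [add_assoc, add_comm β α]
  exact congrArg (fun φ : Mer N →+* Mer N => φ f) key

theorem muL_muR (f f' : Mer N) : muL q f * muR q f' = muR q f' * muL q f := by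
  have h1 := toFR_rel (Rel.l_r (q := q) f f')
  rw [map_mul, map_mul] at h1
  exact h1

theorem muR_t (f : Mer N) (i j : Fin N) : muR q f * t q i j = t q i j * muR q (T (ω j) f) := by
  have h1 := toFR_rel (Rel.r_t (q := q) f i j)
  rw [map_mul, map_mul] at h1
  exact h1

theorem muR_minor (ρ : Equiv.Perm (Fin 2)) (i j k l : Fin N) (f : Mer N) :
    muR q f * minor q ρ ![i, j] ![k, l] = minor q ρ ![i, j] ![k, l] * muR q (T (ω k + ω l) f) := by
  have hw : T (ω k + ω l) f = T (ω (![k, l] (ρ 1))) (T (ω (![k, l] (ρ 0))) f) := by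
    rw [← T_add]
    congr 2
    obtain h0 | h0 : ρ 0 = 0 ∨ ρ 0 = 1 := by omega
    · have h1 : ρ 1 = 1 := by
        have : ρ 1 ≠ ρ 0 := fun e => by simpa using ρ.injective e
        omega
      rw [h0, h1]; rfl
    · have h1 : ρ 1 = 0 := by
        have : ρ 1 ≠ ρ 0 := fun e => by simpa using ρ.injective e
        omega
      rw [h0, h1, add_comm]; rfl
  rw [minor, ← mul_assoc, ← map_mul, mul_comm f, map_mul, mul_assoc, mul_assoc, Finset.mul_sum,
    Finset.sum_mul]
  congr 1
  refine Finset.sum_congr rfl fun σ _ => ?_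
  rw [← mul_assoc, ← muL_muR, mul_assoc, mul_assoc]
  congr 1
  simp only [List.ofFn_succ, List.ofFn_zero, List.prod_cons, List.prod_nil, mul_one]
  rw [← mul_assoc, muR_t, mul_assoc, muR_t, ← mul_assoc]
  exact congrArg (fun e => _ * muR q e) hw.symm

theorem tmul_mem_multipliers {β : Fin N → ℂ} {s : FR q N} {b : B}
    (hs : ∀ f, muR q f * s = s * muR q (T β f)) (hb : ∀ f, ι f * b = b * ι (T β f)) :
    s ⊗ₜ[ℂ] b ∈ multipliers q ι := by
  intro y hy
  induction hy using Submodule.span_induction with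
  | mem y hy =>
    obtain ⟨f, s', b', rfl⟩ := hy
    obtain ⟨f, rfl⟩ := (T β).surjective f
    rw [mul_sub, Algebra.TensorProduct.tmul_mul_tmul, Algebra.TensorProduct.tmul_mul_tmul,
      ← mul_assoc, ← mul_assoc, ← hs, ← hb, mul_assoc, mul_assoc]
    exact Submodule.subset_span ⟨f, s * s', b * b', rfl⟩
  | zero => simp
  | add y y' _ _ hy hy' => rw [mul_add]; exact Submodule.add_mem _ hy hy'
  | smul c y _ hy => rw [mul_smul_comm]; exact Submodule.smul_mem _ c hy

theorem leftAct_mem (f : Mer N) : leftAct q B f ∈ multipliers q ι := by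
  intro y hy
  induction hy using Submodule.span_induction with
  | mem y hy =>
    obtain ⟨f', s', b', rfl⟩ := hy
    change (muL q f ⊗ₜ[ℂ] (1 : B)) * _ ∈ _
    rw [mul_sub, Algebra.TensorProduct.tmul_mul_tmul, Algebra.TensorProduct.tmul_mul_tmul,
      ← mul_assoc, muL_muR, mul_assoc, one_mul, one_mul]
    exact Submodule.subset_span ⟨f', muL q f * s', b', rfl⟩
  | zero => simp
  | add y y' _ _ hy hy' => rw [mul_add]; exact Submodule.add_mem _ hy hy'
  | smul c y _ hy => rw [mul_smul_comm]; exact Submodule.smul_mem _ c hy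

theorem cElt_mem (κ : Fin N → Fin N → Fin N → Fin N → Equiv.Perm (Fin 2))
    {b : Fin N → Fin N → B} (hb : IsHomogeneous ι b) (i j : Fin N) :
    cElt q κ b i j ∈ multipliers q ι := by
  refine Subalgebra.sum_mem _ fun p hp => ?_
  exact tmul_mem_multipliers q ι (muR_minor q _ _ _ _ _)
    (hb p.1 p.2 (Finset.mem_filter.1 hp).2)

/-- The left action of the meromorphic functions, inside `TwistedAlg`. -/
def leftActAlg : Mer N →+* TwistedAlg q ι :=
  (TwistedAlg.cls q ι).comp
    ((leftAct q B).toRingHom.codRestrict (multipliers q ι) (leftAct_mem q ι))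

/-- The element `c_{ij}` of `TwistedAlg`. -/
def cAlg (κ : Fin N → Fin N → Fin N → Fin N → Equiv.Perm (Fin 2))
    {b : Fin N → Fin N → B} (hb : IsHomogeneous ι b) (i j : Fin N) : TwistedAlg q ι :=
  TwistedAlg.cls q ι ⟨cElt q κ b i j, cElt_mem q ι κ hb i j⟩

end Twisted

end DynPf

end

noncomputable section

namespace DynPf

/-! ### The functions `h(λ_i - λ_j)` -/

/-! Expand `Pf(C)` multilinearly in the ordinary tensor product. Each sequence of increasing column
pairs contributes an elementary tensor: its second factor is a product of the `b_{kl}`, its first a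
signed sum over `Π` of products of two by two minors. Laplace expansion along pairs of rows
(`sum_shuffles_minorTwo`) turns this first factor into the full alternating sum `altSum q J` over
`S_{2n}`, where `J` lists the columns in order.

As a function of `J`, `altSum` behaves like a determinant: it vanishes if a column repeats
(`altSum_eq_zero_of_not_injective`), and for a permutation `τ` it is `μ_r(S(τ))` times the
determinant (`altSum_perm`). Only the `τ ∈ Π` survive, giving `∑ μ_r(S(τ)) det(T) ⊗ b_{τ(1)τ(2)} ⋯`.
The relation `μ_r(f)s ⊗ b = s ⊗ fb` moves `S(τ)` to the right factor, where the sum becomes `Pf(B)`.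
The quotient enters only here; homogeneity serves to make the product well defined on classes.

Both properties of `altSum` are local. Grouping `σ` with its composite with an adjacent
transposition produces two by two minors at the two places (`altSum_eq_sum_minorTwo`). For these,
equal columns give zero by `Rel.col`, and interchanging columns gives a factor `-h(μ_l - μ_k)` by
`Rel.diag` and `Rel.diag'`. Such factors are nonzero meromorphic functions, hence can be cancelled.
-/

theorem X_sub_algebraMap_ne_zero {N : ℕ} {q : ℂ} (hq0 : q ≠ 0) (hq : q ^ 2 ≠ 1) {i j : Fin N}
    (hij : i ≠ j) (c : ℂ) : X q i j - algebraMap ℂ (Mer N) c ≠ 0 := by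
  intro h0
  rw [X, IsScalarTower.algebraMap_apply ℂ (Entire N) (Mer N), sub_eq_zero] at h0
  have h1 := congrArg Subtype.val (IsFractionRing.injective (Entire N) (Mer N) h0)
  -- At `0` and at `e_j` the function takes the values `1` and `q ^ 2`; if it were constant, `q ^ 2
  -- = 1` would follow.
  have h2 : Complex.exp (Complex.log q * (-2 * ((0 : Fin N → ℂ) i - (0 : Fin N → ℂ) j))) = c :=
    congrFun h1 0
  have h3 : Complex.exp (Complex.log q * (-2 * ((Pi.single j 1 : Fin N → ℂ) i
      - (Pi.single j 1 : Fin N → ℂ) j))) = c := congrFun h1 (Pi.single j 1)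
  rw [Pi.single_eq_same, Pi.single_eq_of_ne hij] at h3
  apply hq
  have h4 : q ^ 2 = Complex.exp (Complex.log q * (-2 * (0 - 1))) := by
    rw [show Complex.log q * (-2 * (0 - 1)) = ((2 : ℕ) : ℂ) * Complex.log q by push_cast; ring,
      Complex.exp_nat_mul, Complex.exp_log hq0]
  rw [h4, h3, ← h2]
  simp

theorem h_ne_zero {N : ℕ} {q : ℂ} (hq0 : q ≠ 0) (hq : q ^ 2 ≠ 1) {i j : Fin N}
    (hij : i ≠ j) : h q i j ≠ 0 := by
  refine div_ne_zero (mul_ne_zero ?_ (X_sub_algebraMap_ne_zero hq0 hq hij _)) ?_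
  · rwa [Ne, map_eq_zero_iff _ (algebraMap ℂ (Mer N)).injective]
  · simpa using X_sub_algebraMap_ne_zero hq0 hq hij 1

theorem T_algebraMap {N : ℕ} (α : Fin N → ℂ) (c : ℂ) :
    T α (algebraMap ℂ (Mer N) c) = algebraMap ℂ (Mer N) c := by
  rw [IsScalarTower.algebraMap_apply ℂ (Entire N) (Mer N), T_comp_algebraMap, AlgHom.commutes]

/-- Only the difference of the two coordinates enters, and a shift with equal components there
preserves it. -/
theorem T_h {N : ℕ} (q : ℂ) {α : Fin N → ℂ} {i j : Fin N} (hα : α i = α j) :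
    T α (h q i j) = h q i j := by
  have hX : T α (X q i j) = X q i j := by
    rw [X, T_comp_algebraMap]
    congr 1
    ext x
    change Complex.exp (Complex.log q * (-2 * ((x + α) i - (x + α) j)))
      = Complex.exp (Complex.log q * (-2 * (x i - x j)))
    rw [Pi.add_apply, Pi.add_apply, hα, add_sub_add_right_eq_sub]
  simp only [h, map_div₀, map_mul, map_sub, map_one, T_algebraMap, hX]

theorem T_ω_h {N : ℕ} (q : ℂ) {i j k : Fin N} (hi : k ≠ i) (hj : k ≠ j) :
    T (ω k) (h q i j) = h q i j :=
  T_h q (by simp [ω, hi.symm, hj.symm])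

/-! ### Two by two minors -/

theorem muL_t {N : ℕ} (q : ℂ) (f : Mer N) (i j : Fin N) :
    muL q f * t q i j = t q i j * muL q (T (ω i) f) := by
  have h1 := toFR_rel (Rel.l_t (q := q) f i j)
  rw [map_mul, map_mul] at h1
  exact h1

/-- The two by two minor with rows `i < j` and columns `k`, `l` in an arbitrary order, without
its normalizing factor. -/
def minorTwo (q : ℂ) {N : ℕ} (i j k l : Fin N) : FR q N :=
  t q i k * t q j l - muL q (h q j i) * (t q j k * t q i l)

theorem minorTwo_self (q : ℂ) {N : ℕ} {i j : Fin N} (hij : i < j) (k : Fin N) :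
    minorTwo q i j k k = 0 := by
  have h1 := toFR_rel (Rel.col (q := q) i j k hij)
  simp only [map_mul] at h1
  exact sub_eq_zero.2 h1.symm

theorem minorTwo_swap (q : ℂ) {N : ℕ} {i j k l : Fin N} (hij : i < j) (hkl : k < l) :
    minorTwo q i j l k = muR q (-h q l k) * minorTwo q i j k l := by
  have h1 : t q i k * t q j l = t q j l * t q i k
      + (muL q (h q j i) - muR q (h q k l)) * (t q j k * t q i l) := by
    have := toFR_rel (Rel.diag (q := q) i j k l hij hkl)
    simp only [map_mul, map_add, map_sub] at this
    exact this
  have h2 : t q i l * t q j k = muR q (g q k l) * (t q j k * t q i l)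
      + (muL q (h q j i) - muR q (h q l k)) * (t q j l * t q i k) := by
    have := toFR_rel (Rel.diag' (q := q) i j k l hij hkl)
    simp only [map_mul, map_add, map_sub] at this
    exact this
  rw [minorTwo, minorTwo, h1, h2, g, mul_comm (h q k l), map_mul, map_neg]
  noncomm_ring

theorem sgn_two_one (q : ℂ) {N : ℕ} (I : Fin 2 → Fin N) : sgn q 1 I = 1 := by
  refine Finset.prod_eq_one fun p hp => ?_
  have := (Finset.mem_filter.1 hp).2
  exact absurd this.1 this.2.asymm

theorem sgn_two_swap (q : ℂ) {N : ℕ} (I : Fin 2 → Fin N) :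
    sgn q (Equiv.swap 0 1) I = -h q (I 1) (I 0) := by
  have : (Finset.univ.filter fun p : Fin 2 × Fin 2 =>
      p.1 < p.2 ∧ Equiv.swap (0 : Fin 2) 1 p.2 < Equiv.swap (0 : Fin 2) 1 p.1) = {(0, 1)} := by
    decide
  rw [sgn, this, Finset.prod_singleton, Equiv.swap_apply_left, Equiv.swap_apply_right]

/-- The normalizing factor of the minor cancels the factor from interchanging the columns, so the
choice of `ρ` is immaterial. -/
theorem minor_two {N : ℕ} {q : ℂ} (hq0 : q ≠ 0) (hq : q ^ 2 ≠ 1) (ρ : Equiv.Perm (Fin 2))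
    {i j k l : Fin N} (hij : i < j) (hkl : k < l) :
    minor q ρ ![i, j] ![k, l] = minorTwo q i j k l := by
  have hu : (Finset.univ : Finset (Equiv.Perm (Fin 2))) = {1, Equiv.swap 0 1} := by decide
  have hs : (1 : Equiv.Perm (Fin 2)) ≠ Equiv.swap 0 1 := by decide
  have key : ∀ k l : Fin N, ∀ ρ : Equiv.Perm (Fin 2),
      ∑ σ : Equiv.Perm (Fin 2), muL q (sgn q σ ![i, j]) *
        (List.ofFn fun a : Fin 2 => t q (![i, j] (σ a)) (![k, l] (ρ a))).prod
      = minorTwo q i j (![k, l] (ρ 0)) (![k, l] (ρ 1)) := by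
    intro k l ρ
    rw [hu, Finset.sum_pair hs, sgn_two_one, sgn_two_swap]
    simp [List.ofFn_succ, minorTwo, sub_eq_add_neg]
  rw [minor, key]
  have hρ : ρ = 1 ∨ ρ = Equiv.swap 0 1 := by
    have := Finset.mem_univ ρ
    rw [hu] at this
    simpa using this
  obtain rfl | rfl := hρ
  · rw [sgn_two_one]; simp
  · rw [sgn_two_swap]
    simp only [Equiv.swap_apply_left, Equiv.swap_apply_right, Matrix.cons_val_one,
      Matrix.cons_val_zero]
    rw [minorTwo_swap q hij hkl, ← mul_assoc, ← map_mul,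
      inv_mul_cancel₀ (neg_ne_zero.2 (h_ne_zero hq0 hq hkl.ne')), map_one, one_mul]

theorem muL_commute_minorTwo {N : ℕ} (q : ℂ) {f : Mer N} {i j : Fin N}
    (hi : T (ω i) f = f) (hj : T (ω j) f = f) (k l : Fin N) :
    Commute (muL q f) (minorTwo q i j k l) := by
  have c : ∀ i, T (ω i) f = f → ∀ k, Commute (muL q f) (t q i k) := fun i hi k => by
    rw [commute_iff_eq, muL_t, hi]
  refine Commute.sub_right ((c i hi k).mul_right (c j hj l)) (Commute.mul_right ?_
    ((c j hj k).mul_right (c i hi l)))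
  rw [commute_iff_eq, ← map_mul, mul_comm, map_mul]

/-! ### Generalized signs and adjacent transpositions -/

/-- Composing with an adjacent transposition creates exactly one new inversion, at the places `(a,
b)`; all other inversions are carried along by reindexing the pairs of places. -/
theorem sgn_mul_swap (q : ℂ) {N : ℕ} (σ : Equiv.Perm (Fin N)) {a b : Fin N}
    (hab : a.1 + 1 = b.1) (hσ : σ a < σ b) :
    sgn q (σ * Equiv.swap a b) id = sgn q σ id * -h q (σ b) (σ a) := by
  set s := Equiv.swap a b with hs
  have hsgn : sgn q σ id = ∏ p : Fin N × Fin N,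
      if s p.1 < s p.2 ∧ σ (s p.2) < σ (s p.1) then -h q (σ (s p.1)) (σ (s p.2)) else 1 := by
    rw [sgn, Finset.prod_filter]
    exact (Fintype.prod_equiv (s.prodCongr s) _ _ fun p => rfl).symm
  have hone : -h q (σ b) (σ a)
      = ∏ p : Fin N × Fin N, if p = (a, b) then -h q (σ b) (σ a) else 1 := by
    rw [Finset.prod_ite_eq' Finset.univ (a, b) fun _ => -h q (σ b) (σ a),
      if_pos (Finset.mem_univ _)]
  rw [hsgn, hone, sgn, Finset.prod_filter, ← Finset.prod_mul_distrib]
  refine Finset.prod_congr rfl fun p _ => ?_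
  obtain ⟨c, d⟩ := p
  simp only [Equiv.Perm.mul_apply, id_eq, Prod.mk.injEq]
  by_cases h1 : c = a ∧ d = b
  · obtain ⟨rfl, rfl⟩ := h1
    have hlt : c < d := by omega
    simp [hs, hlt, hlt.asymm, hσ]
  by_cases h2 : c = b ∧ d = a
  · obtain ⟨rfl, rfl⟩ := h2
    have hlt : d < c := by omega
    simp [hs, hlt.asymm, hlt.ne, hlt.ne', hσ.asymm]
  -- Since `a` and `b` are adjacent, the transposition preserves the order of every other pair of
  -- places.
  have hlt : s c < s d ↔ c < d := by
    rw [hs, Equiv.swap_apply_def, Equiv.swap_apply_def]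
    split_ifs <;> omega
  simp only [hlt, if_neg h1, mul_one]
  congr

theorem sgn_one (q : ℂ) {N : ℕ} : sgn q (1 : Equiv.Perm (Fin N)) id = 1 := by
  refine Finset.prod_eq_one fun p hp => ?_
  have := (Finset.mem_filter.1 hp).2
  exact absurd this.1 this.2.asymm

theorem sgn_ne_zero {N : ℕ} {q : ℂ} (hq0 : q ≠ 0) (hq : q ^ 2 ≠ 1) (σ : Equiv.Perm (Fin N)) :
    sgn q σ id ≠ 0 :=
  Finset.prod_ne_zero_iff.2 fun _ hp =>
    neg_ne_zero.2 (h_ne_zero hq0 hq (Finset.mem_filter.1 hp).2.2.ne')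

/-- Stated for any stable set `S`, since the grouping of rows also applies it to permutations
already ordered on some pairs. -/
theorem sum_perm_eq_sum_lt {N : ℕ} {M : Type*} [AddCommMonoid M]
    (S : Finset (Equiv.Perm (Fin N))) {a b : Fin N} (hab : a ≠ b)
    (hS : ∀ σ ∈ S, σ * Equiv.swap a b ∈ S) (F : Equiv.Perm (Fin N) → M) :
    ∑ σ ∈ S, F σ = ∑ σ ∈ S with σ a < σ b, (F σ + F (σ * Equiv.swap a b)) := by
  rw [← Finset.sum_filter_add_sum_filter_not S (fun σ => σ a < σ b), Finset.sum_add_distrib]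
  congr 1
  refine Finset.sum_nbij' (· * Equiv.swap a b) (· * Equiv.swap a b) ?_ ?_ ?_ ?_ ?_
  · intro σ hσ
    rw [Finset.mem_filter] at hσ ⊢
    refine ⟨hS _ hσ.1, ?_⟩
    have : σ a ≠ σ b := fun e => hab (σ.injective e)
    simp only [Equiv.Perm.mul_apply, Equiv.swap_apply_left, Equiv.swap_apply_right]
    have := hσ.2
    omega
  · intro σ hσ
    rw [Finset.mem_filter] at hσ ⊢
    refine ⟨hS _ hσ.1, ?_⟩
    simp only [Equiv.Perm.mul_apply, Equiv.swap_apply_left, Equiv.swap_apply_right]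
    exact hσ.2.asymm
  all_goals intro σ _; simp [mul_assoc]

/-! ### Products of lists -/

theorem prod_ofFn_eq_take_mul_drop {A : Type*} [Monoid A] {n : ℕ} (f : Fin n → A) (a : Fin n) :
    (List.ofFn f).prod = ((List.ofFn f).take a).prod * f a * ((List.ofFn f).drop (a + 1)).prod := by
  have h1 : (List.ofFn f).drop a = f a :: (List.ofFn f).drop (a + 1) := by
    rw [List.drop_eq_getElem_cons (by simp)]
    simp
  rw [mul_assoc, ← List.prod_cons, ← h1, ← List.prod_append, List.take_append_drop]

theorem prod_ofFn_eq_take_mul_mul_drop {A : Type*} [Monoid A] {n : ℕ} (f : Fin n → A)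
    {a b : Fin n} (hab : a.1 + 1 = b.1) :
    (List.ofFn f).prod
      = ((List.ofFn f).take a).prod * (f a * f b) * ((List.ofFn f).drop (b + 1)).prod := by
  have h1 : (List.ofFn f).drop (a + 1) = f b :: (List.ofFn f).drop (b + 1) := by
    rw [hab, List.drop_eq_getElem_cons (by simp)]
    simp
  rw [prod_ofFn_eq_take_mul_drop f a, h1, List.prod_cons]
  simp only [mul_assoc]

theorem prod_ofFn_two_mul {A : Type*} [Monoid A] {n : ℕ} (f : Fin (2 * n) → A) :
    (List.ofFn f).prod = (List.ofFn fun a : Fin n => f (fstPos a) * f (sndPos a)).prod := by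
  induction n with
  | zero => simp
  | succ n ih =>
    have h1 : List.ofFn f = f (fstPos 0) :: f (sndPos 0) ::
        List.ofFn fun c : Fin (2 * n) => f ⟨c.1 + 2, by omega⟩ := by
      refine List.ext_getElem (by simp [Nat.mul_succ]) fun c hc hc' => ?_
      rcases c with _ | _ | c <;> simp [fstPos, sndPos]
    rw [h1, List.prod_cons, List.prod_cons, ih, List.ofFn_succ, List.prod_cons, mul_assoc]
    rfl

theorem take_ofFn_congr {A : Type*} {n : ℕ} {f f' : Fin n → A} {a : ℕ}
    (hf : ∀ c : Fin n, c.1 < a → f c = f' c) : (List.ofFn f).take a = (List.ofFn f').take a := by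
  refine List.ext_getElem (by simp) fun c hc hc' => ?_
  simp only [List.length_take, List.length_ofFn, lt_min_iff] at hc
  simp [hf ⟨c, hc.2⟩ hc.1]

theorem drop_ofFn_congr {A : Type*} {n : ℕ} {f f' : Fin n → A} {a : ℕ}
    (hf : ∀ c : Fin n, a ≤ c.1 → f c = f' c) : (List.ofFn f).drop a = (List.ofFn f').drop a := by
  refine List.ext_getElem (by simp) fun c hc hc' => ?_
  simp only [List.length_drop, List.length_ofFn] at hc
  simp [hf ⟨a + c, by omega⟩ (by simp)]

theorem exists_of_mem_take_ofFn {A : Type*} {n : ℕ} {f : Fin n → A} {a : ℕ} {x : A}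
    (hx : x ∈ (List.ofFn f).take a) : ∃ c : Fin n, c.1 < a ∧ f c = x := by
  obtain ⟨c, hc, rfl⟩ := List.mem_iff_getElem.1 hx
  simp only [List.length_take, List.length_ofFn, lt_min_iff] at hc
  exact ⟨⟨c, hc.2⟩, hc.1, by simp⟩

theorem prod_ofFn_tmul {A B : Type*} [Ring A] [Algebra ℂ A] [Ring B] [Algebra ℂ B] {n : ℕ}
    (x : Fin n → A) (y : Fin n → B) :
    (List.ofFn fun a => x a ⊗ₜ[ℂ] y a).prod = (List.ofFn x).prod ⊗ₜ[ℂ] (List.ofFn y).prod := by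
  induction n with
  | zero => simp [Algebra.TensorProduct.one_def]
  | succ n ih => simp [List.ofFn_succ, ih]

theorem prod_ofFn_sum {A κ : Type*} [Ring A] [Algebra ℂ A] [DecidableEq κ] {n : ℕ} (s : Finset κ)
    (x : Fin n → κ → A) :
    (List.ofFn fun a => ∑ p ∈ s, x a p).prod
      = ∑ r ∈ Fintype.piFinset fun _ : Fin n => s, (List.ofFn fun a => x a (r a)).prod := by
  have := (MultilinearMap.mkPiAlgebraFin ℂ n A).map_sum_finset x fun _ => s
  simpa using this

/-! ### Alternating sums with arbitrary columns -/

/-- The alternating sum over the rows of the products with columns `J`. -/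
def altSum (q : ℂ) {N : ℕ} (J : Fin N → Fin N) : FR q N :=
  ∑ σ : Equiv.Perm (Fin N), muL q (sgn q σ id) * (List.ofFn fun c => t q (σ c) (J c)).prod

theorem det_eq_altSum (q : ℂ) {N : ℕ} (ρ : Equiv.Perm (Fin N)) :
    det q ρ = muR q (sgn q ρ id)⁻¹ * altSum q ρ := rfl

/-- If the rows at two adjacent places are interchanged, the two terms of an alternating sum
combine to a two by two minor. -/
theorem sgn_mul_add_swap (q : ℂ) {N : ℕ} {σ : Equiv.Perm (Fin N)} {a b : Fin N}
    (hab : a.1 + 1 = b.1) (hσ : σ a < σ b) {P R : FR q N} (k l : Fin N)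
    (hP : Commute (muL q (h q (σ b) (σ a))) P) :
    muL q (sgn q σ id) * (P * (t q (σ a) k * t q (σ b) l) * R)
      + muL q (sgn q (σ * Equiv.swap a b) id) * (P * (t q (σ b) k * t q (σ a) l) * R)
      = muL q (sgn q σ id) * (P * minorTwo q (σ a) (σ b) k l * R) := by
  rw [sgn_mul_swap q σ hab hσ, map_mul, mul_assoc (muL q (sgn q σ id)), ← mul_add]
  congr 1
  rw [map_neg, minorTwo, mul_sub, sub_mul, sub_eq_add_neg, neg_mul, ← mul_assoc P (muL q _),
    ← hP.eq]
  simp only [mul_assoc]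

/-- The terms of `σ` and `σ * swap a b` differ only at the two places and by one factor of the sign.
That factor commutes with the preceding generators, whose rows are neither `σ a` nor `σ b`. -/
theorem altSum_eq_sum_minorTwo (q : ℂ) {N : ℕ} (J : Fin N → Fin N) {a b : Fin N}
    (hab : a.1 + 1 = b.1) :
    altSum q J = ∑ σ : Equiv.Perm (Fin N) with σ a < σ b, muL q (sgn q σ id) *
      (((List.ofFn fun c => t q (σ c) (J c)).take a).prod
        * minorTwo q (σ a) (σ b) (J a) (J b)
        * ((List.ofFn fun c => t q (σ c) (J c)).drop (b + 1)).prod) := by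
  have hne : a ≠ b := by omega
  rw [altSum, sum_perm_eq_sum_lt Finset.univ hne (fun σ _ => Finset.mem_univ _)]
  refine Finset.sum_congr rfl fun σ hσ => ?_
  rw [prod_ofFn_eq_take_mul_mul_drop _ hab, prod_ofFn_eq_take_mul_mul_drop _ hab,
    take_ofFn_congr (f := fun c => t q ((σ * Equiv.swap a b) c) (J c))
      (f' := fun c => t q (σ c) (J c)),
    drop_ofFn_congr (f := fun c => t q ((σ * Equiv.swap a b) c) (J c))
      (f' := fun c => t q (σ c) (J c))]
  · simp only [Equiv.Perm.mul_apply, Equiv.swap_apply_left, Equiv.swap_apply_right]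
    refine sgn_mul_add_swap q hab (Finset.mem_filter.1 hσ).2 _ _ (Commute.list_prod_right _ _ ?_)
    intro x hx
    obtain ⟨c, hc, rfl⟩ := exists_of_mem_take_ofFn hx
    rw [commute_iff_eq, muL_t, T_ω_h]
    · exact fun e => by have := σ.injective e; omega
    · exact fun e => by have := σ.injective e; omega
  · intro c hc
    rw [Equiv.Perm.mul_apply, Equiv.swap_apply_of_ne_of_ne] <;> omega
  · intro c hc
    rw [Equiv.Perm.mul_apply, Equiv.swap_apply_of_ne_of_ne] <;> omega

/-- The weight of the first `a` columns. -/
def colWeight {N : ℕ} (J : Fin N → Fin N) (a : ℕ) : Fin N → ℂ :=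
  ∑ c : Fin N with c.1 < a, ω (J c)

theorem T_zero {N : ℕ} (f : Mer N) : T 0 f = f := by
  apply (T (0 : Fin N → ℂ)).injective
  rw [← T_add, add_zero]

theorem muR_mul_prod_take (q : ℂ) {N : ℕ} (I J : Fin N → Fin N) {a : ℕ} (ha : a ≤ N)
    (f : Mer N) :
    muR q f * ((List.ofFn fun c => t q (I c) (J c)).take a).prod
      = ((List.ofFn fun c => t q (I c) (J c)).take a).prod * muR q (T (colWeight J a) f) := by
  induction a with
  | zero => simp [colWeight, T_zero]
  | succ a ih =>
    have hw : colWeight J (a + 1) = colWeight J a + ω (J ⟨a, ha⟩) := by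
      have : (Finset.univ.filter fun c : Fin N => c.1 < a + 1)
          = insert ⟨a, ha⟩ (Finset.univ.filter fun c : Fin N => c.1 < a) := by
        ext c
        simp only [Finset.mem_filter, Finset.mem_univ, true_and, Finset.mem_insert, Fin.ext_iff]
        omega
      rw [colWeight, this, Finset.sum_insert (by simp), add_comm]
      rfl
    rw [List.take_add_one, List.getElem?_eq_getElem (by simpa using ha), List.getElem_ofFn,
      Option.toList_some, List.prod_append, List.prod_singleton, ← mul_assoc, ih (by omega),
      mul_assoc, muR_t, hw, T_add, mul_assoc]

/-- Interchanging two adjacent columns. -/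
theorem altSum_comp_swap (q : ℂ) {N : ℕ} {J : Fin N → Fin N} {a b : Fin N}
    (hab : a.1 + 1 = b.1) (hJ : J a < J b) :
    altSum q (J ∘ Equiv.swap a b)
      = muR q ((T (colWeight J a)).symm (-h q (J b) (J a))) * altSum q J := by
  rw [altSum_eq_sum_minorTwo q _ hab, altSum_eq_sum_minorTwo q J hab, Finset.mul_sum]
  refine Finset.sum_congr rfl fun σ hσ => ?_
  rw [take_ofFn_congr (f := fun c => t q (σ c) ((J ∘ Equiv.swap a b) c))
      (f' := fun c => t q (σ c) (J c)),
    drop_ofFn_congr (f := fun c => t q (σ c) ((J ∘ Equiv.swap a b) c))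
      (f' := fun c => t q (σ c) (J c))]
  · simp only [Function.comp_apply, Equiv.swap_apply_left, Equiv.swap_apply_right]
    -- The factor from the minor stands behind the first `a` generators; bringing it to the front
    -- undoes the shift by their column weight.
    rw [minorTwo_swap q (Finset.mem_filter.1 hσ).2 hJ, ← mul_assoc, ← mul_assoc, ← mul_assoc,
      ← mul_assoc, ← mul_assoc, ← mul_assoc, ← muL_muR, mul_assoc (muL q _) (muR q _),
      muR_mul_prod_take q σ J a.2.le, RingEquiv.apply_symm_apply, ← mul_assoc]
  · intro c hc
    rw [Function.comp_apply, Equiv.swap_apply_of_ne_of_ne] <;> omega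
  · intro c hc
    rw [Function.comp_apply, Equiv.swap_apply_of_ne_of_ne] <;> omega

theorem altSum_eq_zero {N : ℕ} {q : ℂ} (hq0 : q ≠ 0) (hq : q ^ 2 ≠ 1) (d : ℕ) :
    ∀ {J : Fin N → Fin N} {a b : Fin N}, a.1 + d + 1 = b.1 → J a = J b → altSum q J = 0 := by
  have adj : ∀ {J : Fin N → Fin N} {a b : Fin N}, a.1 + 1 = b.1 → J a = J b → altSum q J = 0 := by
    intro J a b hab hJ
    rw [altSum_eq_sum_minorTwo q J hab]
    refine Finset.sum_eq_zero fun σ hσ => ?_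
    rw [hJ, minorTwo_self q (Finset.mem_filter.1 hσ).2, mul_zero, zero_mul, mul_zero]
  induction d with
  | zero => exact fun hab => adj hab
  | succ d ih =>
    intro J a b hab hJ
    -- Interchanging the places `b - 1` and `b` brings the two equal columns one step closer, where
    -- the induction hypothesis applies.
    let b' : Fin N := ⟨a.1 + d + 1, by omega⟩
    have hb : b'.1 + 1 = b.1 := by simp only [b']; omega
    have h0 : altSum q (J ∘ Equiv.swap b' b) = 0 := by
      refine ih (a := a) (b := b') rfl ?_
      rw [Function.comp_apply, Function.comp_apply, Equiv.swap_apply_left,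
        Equiv.swap_apply_of_ne_of_ne, hJ]
      · exact fun e => by have := congrArg Fin.val e; simp only [b'] at this; omega
      · omega
    -- The interchange formula starts from increasing columns. In the first case its factor must be
    -- cancelled; in the last case it is read from the interchanged sequence back to `J`.
    rcases lt_trichotomy (J b') (J b) with hlt | heq | hgt
    · rw [altSum_comp_swap q hb hlt] at h0
      have hne : (T (colWeight J b')).symm (-h q (J b) (J b')) ≠ 0 := by
        rw [Ne, map_eq_zero_iff _ (RingEquiv.injective _)]
        exact neg_ne_zero.2 (h_ne_zero hq0 hq hlt.ne')
      rw [← one_mul (altSum q J), ← map_one (muR q), ← inv_mul_cancel₀ hne, map_mul, mul_assoc,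
        h0, mul_zero]
    · exact adj hb heq
    · have hJ' : J = (J ∘ Equiv.swap b' b) ∘ Equiv.swap b' b := by
        ext c; simp
      rw [hJ', altSum_comp_swap q hb (by simpa using hgt), h0, mul_zero]

theorem altSum_eq_zero_of_not_injective {N : ℕ} {q : ℂ} (hq0 : q ≠ 0) (hq : q ^ 2 ≠ 1)
    {J : Fin N → Fin N} (hJ : ¬ Function.Injective J) : altSum q J = 0 := by
  rw [Function.Injective] at hJ
  push Not at hJ
  obtain ⟨a, b, hab, hne⟩ := hJ
  rcases lt_or_gt_of_ne hne with hlt | hlt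
  · exact altSum_eq_zero hq0 hq (b.1 - a.1 - 1) (a := a) (b := b) (by omega) hab
  · exact altSum_eq_zero hq0 hq (a.1 - b.1 - 1) (a := b) (b := a) (by omega) hab.symm

/-- For distinct columns the shift in `altSum_comp_swap` disappears: neither `τ a` nor `τ b` occurs
among the first `a` columns. -/
theorem altSum_mul_swap (q : ℂ) {N : ℕ} {τ : Equiv.Perm (Fin N)} {a b : Fin N}
    (hab : a.1 + 1 = b.1) (hτ : τ a < τ b) :
    altSum q (τ * Equiv.swap a b) = muR q (-h q (τ b) (τ a)) * altSum q τ := by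
  have hT : T (colWeight τ a) (-h q (τ b) (τ a)) = -h q (τ b) (τ a) := by
    rw [map_neg, T_h]
    have hz : ∀ d : Fin N, a.1 ≤ d.1 → colWeight τ a (τ d) = 0 := fun d hd => by
      rw [colWeight, Finset.sum_apply]
      refine Finset.sum_eq_zero fun c hc => Pi.single_eq_of_ne (fun e => ?_) _
      have h1 := (Finset.mem_filter.1 hc).2
      have h2 := τ.injective e
      omega
    rw [hz a le_rfl, hz b (by omega)]
  rw [Equiv.Perm.coe_mul, altSum_comp_swap q hab hτ]
  congr 2
  rw [RingEquiv.symm_apply_eq, hT]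

theorem perm_induction_adjacent {N : ℕ} {p : Equiv.Perm (Fin N) → Prop} (one : p 1)
    (mul_swap : ∀ (τ : Equiv.Perm (Fin N)) (a b : Fin N), a.1 + 1 = b.1 → p τ →
      p (τ * Equiv.swap a b)) (τ : Equiv.Perm (Fin N)) : p τ := by
  cases N with
  | zero => rwa [Subsingleton.elim τ 1]
  | succ N =>
    have hτ : τ ∈ (⊤ : Submonoid (Equiv.Perm (Fin (N + 1)))) := trivial
    rw [← Equiv.Perm.mclosure_swap_castSucc_succ] at hτ
    induction hτ using Submonoid.closure_induction_right with
    | one => exact one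
    | mul_right x _ y hy ih =>
      obtain ⟨i, rfl⟩ := hy
      exact mul_swap x _ _ rfl ih

/-- Under an adjacent transposition, `altSum` acquires `μ_r` of the same factor as the generalized
sign, so the two agree along any word in adjacent transpositions. -/
theorem altSum_perm {N : ℕ} {q : ℂ} (hq0 : q ≠ 0) (hq : q ^ 2 ≠ 1) (τ : Equiv.Perm (Fin N)) :
    altSum q τ = muR q (sgn q τ id) * altSum q id := by
  induction τ using perm_induction_adjacent with
  | one => rw [sgn_one, map_one, one_mul]; rfl
  | mul_swap τ a b hab ih =>
    have hne : τ a ≠ τ b := fun e => by have := τ.injective e; omega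
    rcases lt_or_gt_of_ne hne with hlt | hgt
    · rw [altSum_mul_swap q hab hlt, ih, sgn_mul_swap q τ hab hlt, mul_comm (sgn q τ id),
        map_mul, mul_assoc]
    -- The word need not be reduced: here the transposition removes an inversion, so the formula for
    -- `τ` is expressed through `τ'` and the nonzero factor is cancelled.
    · set τ' := τ * Equiv.swap a b with hτ'
      have hlt : τ' a < τ' b := by simpa [hτ'] using hgt
      have hτ : τ = τ' * Equiv.swap a b := by simp [hτ', mul_assoc]
      have hh : -h q (τ' b) (τ' a) ≠ 0 := neg_ne_zero.2 (h_ne_zero hq0 hq hlt.ne')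
      rw [hτ, altSum_mul_swap q hab hlt, sgn_mul_swap q τ' hab hlt, mul_comm (sgn q τ' id),
        map_mul, mul_assoc] at ih
      have := congrArg (muR q (-h q (τ' b) (τ' a))⁻¹ * ·) ih
      simpa only [← mul_assoc, ← map_mul, inv_mul_cancel₀ hh, map_one, one_mul] using this

theorem det_eq {N : ℕ} {q : ℂ} (hq0 : q ≠ 0) (hq : q ^ 2 ≠ 1) (ρ : Equiv.Perm (Fin N)) :
    det q ρ = altSum q id := by
  rw [det_eq_altSum, altSum_perm hq0 hq, ← mul_assoc, ← map_mul,
    inv_mul_cancel₀ (sgn_ne_zero hq0 hq ρ), map_one, one_mul]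

/-! ### Grouping the rows in pairs -/

/-- The contribution of the `a`-th pair of places: a two by two minor for the first `m` pairs, and
a product of two generators for the other ones. -/
def pairFactor (q : ℂ) {n : ℕ} (J : Fin (2 * n) → Fin (2 * n)) (m : ℕ)
    (σ : Equiv.Perm (Fin (2 * n))) (a : Fin n) : FR q (2 * n) :=
  if a.1 < m then minorTwo q (σ (fstPos a)) (σ (sndPos a)) (J (fstPos a)) (J (sndPos a))
  else t q (σ (fstPos a)) (J (fstPos a)) * t q (σ (sndPos a)) (J (sndPos a))

/-- The alternating sum in which the first `m` pairs of rows have been grouped to minors. -/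
def pairSum (q : ℂ) {n : ℕ} (J : Fin (2 * n) → Fin (2 * n)) (m : ℕ) : FR q (2 * n) :=
  ∑ σ : Equiv.Perm (Fin (2 * n)) with ∀ a : Fin n, a.1 < m → σ (fstPos a) < σ (sndPos a),
    muL q (sgn q σ id) * (List.ofFn (pairFactor q J m σ)).prod

/-- Grouping `σ` with its composite with the transposition inside pair `m` forms one more minor. The
sign factor passes the earlier minors because their rows differ from those of pair `m`. -/
theorem pairSum_succ (q : ℂ) {n : ℕ} (J : Fin (2 * n) → Fin (2 * n)) (m : Fin n) :
    pairSum q J m = pairSum q J (m + 1) := by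
  have hab : (fstPos m).1 + 1 = (sndPos m).1 := rfl
  have hswap : ∀ σ : Equiv.Perm (Fin (2 * n)), ∀ a : Fin n, a ≠ m →
      (σ * Equiv.swap (fstPos m) (sndPos m)) (fstPos a) = σ (fstPos a) ∧
      (σ * Equiv.swap (fstPos m) (sndPos m)) (sndPos a) = σ (sndPos a) := by
    intro σ a ha
    have ha' : a.1 ≠ m.1 := fun e => ha (Fin.ext e)
    constructor <;> rw [Equiv.Perm.mul_apply, Equiv.swap_apply_of_ne_of_ne] <;>
      simp only [fstPos, sndPos, Ne, Fin.mk.injEq] <;> omega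
  rw [pairSum, sum_perm_eq_sum_lt _ (a := fstPos m) (b := sndPos m) (by omega), pairSum,
    Finset.filter_filter]
  · have hfil : ∀ σ : Equiv.Perm (Fin (2 * n)),
        ((∀ a : Fin n, a.1 < m.1 → σ (fstPos a) < σ (sndPos a)) ∧ σ (fstPos m) < σ (sndPos m))
          ↔ ∀ a : Fin n, a.1 < m.1 + 1 → σ (fstPos a) < σ (sndPos a) := by
      refine fun σ => ⟨fun hσ a ha => ?_, fun hσ => ⟨fun a ha => hσ a (by omega), hσ m (by omega)⟩⟩
      rcases Nat.lt_succ_iff_lt_or_eq.1 ha with ha | ha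
      · exact hσ.1 a ha
      · rw [Fin.ext ha]; exact hσ.2
    simp only [hfil]
    refine Finset.sum_congr rfl fun σ hσ => ?_
    have hσ' := (Finset.mem_filter.1 hσ).2 m (by omega)
    have htake : ∀ a : Fin n, a.1 < m.1 →
        pairFactor q J m (σ * Equiv.swap (fstPos m) (sndPos m)) a = pairFactor q J m σ a := by
      intro a ha
      obtain ⟨h1, h2⟩ := hswap σ a (by omega)
      rw [pairFactor, pairFactor, h1, h2]
    have hdrop : ∀ a : Fin n, m.1 + 1 ≤ a.1 →
        pairFactor q J m (σ * Equiv.swap (fstPos m) (sndPos m)) a = pairFactor q J m σ a := by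
      intro a ha
      obtain ⟨h1, h2⟩ := hswap σ a (by omega)
      rw [pairFactor, pairFactor, h1, h2]
    have htake' : ∀ a : Fin n, a.1 < m.1 → pairFactor q J (m + 1) σ a = pairFactor q J m σ a := by
      intro a ha
      rw [pairFactor, pairFactor, if_pos (by omega), if_pos ha]
    have hdrop' : ∀ a : Fin n, m.1 + 1 ≤ a.1 →
        pairFactor q J (m + 1) σ a = pairFactor q J m σ a := by
      intro a ha
      rw [pairFactor, pairFactor, if_neg (by omega), if_neg (by omega)]
    rw [prod_ofFn_eq_take_mul_drop _ m, prod_ofFn_eq_take_mul_drop _ m,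
      prod_ofFn_eq_take_mul_drop (pairFactor q J (m + 1) σ) m, take_ofFn_congr htake,
      drop_ofFn_congr hdrop, take_ofFn_congr htake', drop_ofFn_congr hdrop']
    have e1 : pairFactor q J m σ m = t q (σ (fstPos m)) (J (fstPos m))
        * t q (σ (sndPos m)) (J (sndPos m)) := if_neg (lt_irrefl _)
    have e2 : pairFactor q J m (σ * Equiv.swap (fstPos m) (sndPos m)) m
        = t q (σ (sndPos m)) (J (fstPos m)) * t q (σ (fstPos m)) (J (sndPos m)) := by
      rw [pairFactor, if_neg (lt_irrefl _), Equiv.Perm.mul_apply, Equiv.Perm.mul_apply,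
        Equiv.swap_apply_left, Equiv.swap_apply_right]
    have e3 : pairFactor q J (m + 1) σ m = minorTwo q (σ (fstPos m)) (σ (sndPos m))
        (J (fstPos m)) (J (sndPos m)) := if_pos (Nat.lt_succ_self _)
    rw [e1, e2, e3]
    refine sgn_mul_add_swap q hab hσ' _ _ (Commute.list_prod_right _ _ fun x hx => ?_)
    obtain ⟨c, hc, rfl⟩ := exists_of_mem_take_ofFn hx
    rw [pairFactor, if_pos hc]
    refine muL_commute_minorTwo q (T_ω_h q ?_ ?_) (T_ω_h q ?_ ?_) _ _ <;>
    · intro e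
      have := congrArg Fin.val (σ.injective e)
      simp only [fstPos, sndPos] at this
      omega
  -- The transposition inside pair `m` does not touch the order conditions, which concern earlier
  -- pairs only.
  · intro σ hσ
    rw [Finset.mem_filter] at hσ ⊢
    refine ⟨Finset.mem_univ _, fun a ha => ?_⟩
    obtain ⟨h1, h2⟩ := hswap σ a (by omega)
    rw [h1, h2]
    exact hσ.2 a ha

/-- Laplace expansion along pairs of rows, by raising the number of grouped pairs from `0` to `n`.
Arbitrary `J` is essential: different factors `c_{ij}` may contribute the same column. -/
theorem sum_shuffles_minorTwo (q : ℂ) {n : ℕ} (J : Fin (2 * n) → Fin (2 * n)) :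
    ∑ σ ∈ shuffles n, muL q (sgn q σ id) * (List.ofFn fun a : Fin n =>
      minorTwo q (σ (fstPos a)) (σ (sndPos a)) (J (fstPos a)) (J (sndPos a))).prod
      = altSum q J := by
  have h1 : ∀ m ≤ n, pairSum q J m = altSum q J := by
    intro m hm
    induction m with
    | zero =>
      have h0 : ∀ σ, pairFactor q J 0 σ = fun a => t q (σ (fstPos a)) (J (fstPos a))
          * t q (σ (sndPos a)) (J (sndPos a)) := fun σ => funext fun a => if_neg a.1.not_lt_zero
      simp [pairSum, altSum, h0, prod_ofFn_two_mul]
    | succ m ih => rw [← ih (by omega)]; exact (pairSum_succ q J ⟨m, hm⟩).symm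
  have h2 : ∀ σ, pairFactor q J n σ = fun a => minorTwo q (σ (fstPos a)) (σ (sndPos a))
      (J (fstPos a)) (J (sndPos a)) := fun σ => funext fun a => if_pos a.2
  rw [← h1 n le_rfl]
  simp [pairSum, shuffles, h2]

/-! ### The Pfaffian -/

theorem map_Pf (q : ℂ) {n : ℕ} {A A' : Type*} [Ring A] [Ring A'] (φ : A →+* A')
    (ι : Mer (2 * n) →+* A) (x : Fin (2 * n) → Fin (2 * n) → A) :
    φ (Pf q ι x) = Pf q (φ.comp ι) fun i j => φ (x i j) := by
  simp [Pf, map_sum, map_list_prod, List.map_ofFn, Function.comp_def]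

/-- The sequence of columns that is listed by a sequence of pairs. -/
def pairCols {n N : ℕ} (r : Fin n → Fin N × Fin N) (c : Fin (2 * n)) : Fin N :=
  if c.1 % 2 = 0 then (r ⟨c.1 / 2, by omega⟩).1 else (r ⟨c.1 / 2, by omega⟩).2

theorem pairCols_fstPos {n N : ℕ} (r : Fin n → Fin N × Fin N) (a : Fin n) :
    pairCols r (fstPos a) = (r a).1 := by
  simp [pairCols, fstPos]

theorem pairCols_sndPos {n N : ℕ} (r : Fin n → Fin N × Fin N) (a : Fin n) :
    pairCols r (sndPos a) = (r a).2 := by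
  have h1 : (2 * a.1 + 1) / 2 = a.1 := by omega
  simp [pairCols, sndPos, h1]

theorem eq_fstPos_or_eq_sndPos {n : ℕ} (c : Fin (2 * n)) :
    ∃ a : Fin n, c = fstPos a ∨ c = sndPos a := by
  refine ⟨⟨c.1 / 2, by omega⟩, ?_⟩
  simp only [fstPos, sndPos, Fin.ext_iff]
  omega

/-- This holds before passing to the quotient, without any assumption on the `b_{kl}`. -/
theorem Pf_cElt {n : ℕ} {q : ℂ} (hq0 : q ≠ 0) (hq : q ^ 2 ≠ 1) {B : Type*} [Ring B] [Algebra ℂ B]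
    (b : Fin (2 * n) → Fin (2 * n) → B)
    (κ : Fin (2 * n) → Fin (2 * n) → Fin (2 * n) → Fin (2 * n) → Equiv.Perm (Fin 2)) :
    Pf q (leftAct q B).toRingHom (cElt q κ b)
      = ∑ τ ∈ shuffles n, (muR q (sgn q τ id) * altSum q id) ⊗ₜ[ℂ]
          (List.ofFn fun a : Fin n => b (τ (fstPos a)) (τ (sndPos a))).prod := by
  set s : Finset (Fin (2 * n) × Fin (2 * n)) := {p | p.1 < p.2} with hs
  have h1 : Pf q (leftAct q B).toRingHom (cElt q κ b)
      = ∑ r ∈ Fintype.piFinset fun _ : Fin n => s,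
          altSum q (pairCols r) ⊗ₜ[ℂ] (List.ofFn fun a : Fin n => b (r a).1 (r a).2).prod := by
    have h2 : ∀ σ ∈ shuffles n, (leftAct q B).toRingHom (sgn q σ id) *
        (List.ofFn fun a : Fin n => cElt q κ b (σ (fstPos a)) (σ (sndPos a))).prod
        = ∑ r ∈ Fintype.piFinset fun _ : Fin n => s, (muL q (sgn q σ id) *
            (List.ofFn fun a : Fin n => minorTwo q (σ (fstPos a)) (σ (sndPos a))
              (pairCols r (fstPos a)) (pairCols r (sndPos a))).prod) ⊗ₜ[ℂ]
            (List.ofFn fun a : Fin n => b (r a).1 (r a).2).prod := by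
      intro σ hσ
      simp only [cElt]
      rw [prod_ofFn_sum, Finset.mul_sum]
      refine Finset.sum_congr rfl fun r hr => ?_
      rw [prod_ofFn_tmul]
      change (muL q (sgn q σ id) ⊗ₜ[ℂ] (1 : B)) * _ = _
      rw [Algebra.TensorProduct.tmul_mul_tmul, one_mul]
      congr 4
      funext a
      rw [pairCols_fstPos, pairCols_sndPos]
      exact minor_two hq0 hq _ ((Finset.mem_filter.1 hσ).2 a)
        (Finset.mem_filter.1 (Fintype.mem_piFinset.1 hr a)).2
    rw [Pf, Finset.sum_congr rfl h2, Finset.sum_comm]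
    refine Finset.sum_congr rfl fun r _ => ?_
    rw [← TensorProduct.sum_tmul, sum_shuffles_minorTwo]
  rw [h1]
  symm
  have hcols : ∀ τ : Equiv.Perm (Fin (2 * n)),
      pairCols (fun a : Fin n => (τ (fstPos a), τ (sndPos a))) = τ := by
    intro τ
    funext c
    obtain ⟨a, rfl | rfl⟩ := eq_fstPos_or_eq_sndPos c
    · rw [pairCols_fstPos]
    · rw [pairCols_sndPos]
  -- Sequences of increasing pairs without repeated column are exactly the images of `Π`; all others
  -- contribute zero.
  refine Finset.sum_of_injOn (fun τ a => (τ (fstPos a), τ (sndPos a))) ?_ ?_ ?_ ?_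
  · intro τ _ τ' _ e
    apply DFunLike.coe_injective
    rw [← hcols τ, ← hcols τ']
    exact congrArg pairCols e
  · intro τ hτ
    rw [Finset.mem_coe, Fintype.mem_piFinset]
    exact fun a => Finset.mem_filter.2 ⟨Finset.mem_univ _, (Finset.mem_filter.1 hτ).2 a⟩
  · intro r hr hr'
    rw [altSum_eq_zero_of_not_injective hq0 hq, TensorProduct.zero_tmul]
    intro hinj
    apply hr'
    refine ⟨Equiv.ofBijective _ (Finite.injective_iff_bijective.1 hinj), ?_, ?_⟩
    · refine Finset.mem_filter.2 ⟨Finset.mem_univ _, fun a => ?_⟩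
      rw [Equiv.ofBijective_apply, Equiv.ofBijective_apply, pairCols_fstPos, pairCols_sndPos]
      exact (Finset.mem_filter.1 (Fintype.mem_piFinset.1 hr a)).2
    · funext a
      simp only [Equiv.ofBijective_apply, pairCols_fstPos, pairCols_sndPos]
  · intro τ _
    rw [← altSum_perm hq0 hq, hcols]

/-! ### Passage to the twisted tensor product -/

theorem cls_muR_mul_tmul (q : ℂ) {N : ℕ} {B : Type*} [Ring B] [Algebra ℂ B] (ι : Mer N →ₐ[ℂ] B)
    (f : Mer N) (s : FR q N) (b : B) :
    cls q ι ((muR q f * s) ⊗ₜ[ℂ] b) = cls q ι (s ⊗ₜ[ℂ] (ι f * b)) :=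
  (Submodule.Quotient.eq _).2 (Submodule.subset_span ⟨f, s, b, rfl⟩)

theorem cls_Pf_cElt {n : ℕ} {q : ℂ} (hq0 : q ≠ 0) (hq : q ^ 2 ≠ 1) {B : Type*} [Ring B]
    [Algebra ℂ B] (ι : Mer (2 * n) →ₐ[ℂ] B) (b : Fin (2 * n) → Fin (2 * n) → B)
    (ρ : Equiv.Perm (Fin (2 * n)))
    (κ : Fin (2 * n) → Fin (2 * n) → Fin (2 * n) → Fin (2 * n) → Equiv.Perm (Fin 2)) :
    cls q ι (Pf q (leftAct q B).toRingHom (cElt q κ b))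
      = cls q ι (det q ρ ⊗ₜ[ℂ] Pf q ι.toRingHom b) := by
  rw [Pf_cElt hq0 hq, map_sum, det_eq hq0 hq, Pf, TensorProduct.tmul_sum, map_sum]
  exact Finset.sum_congr rfl fun τ _ => cls_muR_mul_tmul q ι _ _ _

/-- The Pfaffian formed in `multipliers q ι` maps to both sides, since ring homomorphisms preserve
Pfaffians: through the quotient to `TwistedAlg`, and through the inclusion to the ordinary tensor
product. -/
theorem incl_Pf_cAlg {n : ℕ} (q : ℂ) {B : Type*} [Ring B] [Algebra ℂ B]
    (ι : Mer (2 * n) →ₐ[ℂ] B) {b : Fin (2 * n) → Fin (2 * n) → B}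
    (κ : Fin (2 * n) → Fin (2 * n) → Fin (2 * n) → Fin (2 * n) → Equiv.Perm (Fin 2))
    (hb : IsHomogeneous ι b) :
    TwistedAlg.incl q ι (Pf q (leftActAlg q ι) (cAlg q ι κ hb))
      = cls q ι (Pf q (leftAct q B).toRingHom (cElt q κ b)) := by
  have h1 := map_Pf q (A' := TwistedAlg q ι) (TwistedAlg.cls q ι)
    ((leftAct q B).toRingHom.codRestrict (multipliers q ι) (leftAct_mem q ι))
    fun i j => ⟨cElt q κ b i j, cElt_mem q ι κ hb i j⟩
  have h2 := map_Pf q (multipliers q ι).val.toRingHom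
    ((leftAct q B).toRingHom.codRestrict (multipliers q ι) (leftAct_mem q ι))
    fun i j => ⟨cElt q κ b i j, cElt_mem q ι κ hb i j⟩
  refine (congrArg (TwistedAlg.incl q ι) h1.symm).trans ?_
  rw [TwistedAlg.incl_cls]
  exact congrArg (cls q ι) h2

end DynPf

end

theorem mainTheorem1 (q : ℂ) (hq0 : q ≠ 0) (hq : ∀ m : ℕ, 0 < m → q ^ m ≠ 1) (n : ℕ)
    {B : Type*} [Ring B] [Algebra ℂ B] (ι : DynPf.Mer (2 * n) →ₐ[ℂ] B)
    (b : Fin (2 * n) → Fin (2 * n) → B)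
    (ρ : Equiv.Perm (Fin (2 * n)))
    (κ : Fin (2 * n) → Fin (2 * n) → Fin (2 * n) → Fin (2 * n) → Equiv.Perm (Fin 2)) :
    DynPf.cls q ι (DynPf.Pf q (DynPf.leftAct q B).toRingHom (DynPf.cElt q κ b))
        = DynPf.cls q ι (DynPf.det q ρ ⊗ₜ[ℂ] DynPf.Pf q ι.toRingHom b)
      ∧ ∀ hb : DynPf.IsHomogeneous ι b,
        DynPf.TwistedAlg.incl q ι (DynPf.Pf q (DynPf.leftActAlg q ι) (DynPf.cAlg q ι κ hb))
          = DynPf.cls q ι (DynPf.det q ρ ⊗ₜ[ℂ] DynPf.Pf q ι.toRingHom b) := by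
  have hcls := DynPf.cls_Pf_cElt hq0 (hq 2 two_pos) ι b ρ κ
  exact ⟨hcls, fun hb => (DynPf.incl_Pf_cAlg q ι κ hb).trans hcls⟩
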